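/- **Theorem 1.5.** Let $r, j, m$ be positive integers with $j \le m$ and $rm \ge 2$, let $H$ be a simple undirected $j$-uniform hypergraph with vertex set $\{1,\dots,m\}$ (every edge of $H$ is a set of exactly $j$ vertices), and let $K$ be a number field of degree $n$ over $\mathbb{Q}$ with ring of integers $\mathcal{O}$. Elements of $\mathcal{O}$ are called relatively $r$-prime if $\mathfrak{p}^r$ does not divide the ideal they generate, for any prime ideal $\mathfrak{p}$ of $\mathcal{O}$. A tuple $(\beta_1,\dots,\beta_m) \in \mathcal{O}^m$ is called $H$-wise relatively $r$-prime if for every edge $e$ of $H$ the elements $\beta_i$ $(i \in e)$ are relatively $r$-prime. Let $E \subseteq \mathcal{O}^m$ be the set of all $H$-wise relatively $r$-prime tuples. For $k \ge 0$ let $i_k(H)$ be the number of $k$-element sets of vertices that contain no edge of $H$. For an integral basis $\mathcal{B} = \{\alpha_1,\dots,\alpha_n\}$ of $\mathcal{O}$ and a positive integer $M$ put $$\mathcal{O}_{\mathcal{B}}[M] = \Big\{\sum_{i=1}^n c_i\alpha_i : c_i \in [-M,M)\cap\mathbb{Z}\Big\}.$$ The upper and lower densities with respect to $\mathcal{B}$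 of a set $T \subseteq \mathcal{O}^m$ are the $\limsup$ and the $\liminf$, as $M \to \infty$, of $|T\cap\mathcal{O}_{\mathcal{B}}[M]^m| \,/\, |\mathcal{O}_{\mathcal{B}}[M]^m|$; if they are equal, their common value is the density $\mathbb{D}_{\mathcal{B}}(T)$ of $T$ with respect to $\mathcal{B}$. Then for every integral basis $\mathcal{B}$ of $\mathcal{O}$ the density $\mathbb{D}_{\mathcal{B}}(E)$ exists and $$\mathbb{D}_{\mathcal{B}}(E) = \prod_{\mathfrak{p}} \Big[\sum_{k=0}^m i_k(H)\Big(1-\frac{1}{\mathfrak{N}(\mathfrak{p}^r)}\Big)^{m-k}\Big(\frac{1}{\mathfrak{N}(\mathfrak{p}^r)}\Big)^k\Big],$$ where the product is over all nonzero prime ideals $\mathfrak{p}$ of $\mathcal{O}$ and $\mathfrak{N}$ is the absolute norm of ideals; the finite partial products converge, independently of the order of the factors, to a limit that may be $0$. In particular the density does not depend on the choice of $\mathcal{B}$. -/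

import Mathlib

open Filter
open scoped NumberField

/-- A hypergraph `H` with vertex set all of `V` is `j`-uniform if every edge of `H` joins
exactly `j` vertices. (Edges form a set of sets, so `H` is simple and undirected.) -/
structure Hypergraph.IsUniformOn {V : Type*} (H : Hypergraph V) (j : ℕ) : Prop where
  vertexSet_eq : H.vertexSet = Set.univ
  ncard_edge : ∀ e ∈ H.edgeSet, e.ncard = j

/-- A set of vertices is independent if it contains no edge of `H`. -/
def Hypergraph.IsIndependent {V : Type*} (H : Hypergraph V) (S : Set V) : Prop :=
  S ⊆ H.vertexSet ∧ ∀ e ∈ H.edgeSet, ¬ e ⊆ S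

/-- `i_k(H)`: the number of independent sets of `k` vertices of `H`. -/
noncomputable def Hypergraph.numIndependent {m : ℕ} (H : Hypergraph (Fin m)) (k : ℕ) : ℕ :=
  {S : Set (Fin m) | S.ncard = k ∧ H.IsIndependent S}.ncard

/-- The elements of a set `A` of a Dedekind domain are relatively `r`-prime if `𝔭 ^ r` does not
divide the ideal generated by `A`, for any prime ideal `𝔭`. (For `r ≥ 1`, in a domain that is not
a field, the zero ideal imposes no further condition: `0 ^ r = 0` divides only the zero ideal,
and that ideal is already excluded by any nonzero prime.) -/
def RelativelyRPrime {D : Type*} [CommRing D] [IsDedekindDomain D] (r : ℕ) (A : Set D) : Prop :=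
  ∀ p : Ideal D, p.IsPrime → ¬ p ^ r ∣ Ideal.span A

/-- The tuple `β = (β₁, …, βₘ)` is `H`-wise relatively `r`-prime if the entries of `β` at the
vertices of any edge of `H` are relatively `r`-prime. -/
def HWiseRelativelyRPrime {D : Type*} [CommRing D] [IsDedekindDomain D] {m : ℕ}
    (H : Hypergraph (Fin m)) (r : ℕ) (β : Fin m → D) : Prop :=
  ∀ e ∈ H.edgeSet, RelativelyRPrime r (β '' e)

/-- The box `𝒪_B[M]` of all `∑ i, c i • α i` with integers `c i ∈ [-M, M)`, where
`B = (α₁, …, αₙ)` is a `ℤ`-basis of `R`. -/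
def integralBox {ι R : Type*} [Fintype ι] [CommRing R] (B : Module.Basis ι ℤ R) (M : ℕ) : Set R :=
  {x | ∃ c : ι → ℤ, (∀ i, c i ∈ Set.Ico (-(M : ℤ)) (M : ℤ)) ∧ x = ∑ i, c i • B i}

/-- The `m`-th cartesian power `𝒪_B[M]ᵐ` of the box. -/
def integralBoxPow {ι R : Type*} [Fintype ι] [CommRing R] (B : Module.Basis ι ℤ R) (m M : ℕ) :
    Set (Fin m → R) :=
  {z | ∀ i, z i ∈ integralBox B M}

/-- The proportion `|T ∩ 𝒪_B[M]ᵐ| / |𝒪_B[M]ᵐ|`. -/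
noncomputable def boxProportion {ι R : Type*} [Fintype ι] [CommRing R] (B : Module.Basis ι ℤ R)
    {m : ℕ} (T : Set (Fin m → R)) (M : ℕ) : ℝ :=
  ((T ∩ integralBoxPow B m M).ncard : ℝ) / ((integralBoxPow B m M).ncard : ℝ)

/-- Upper density of `T` with respect to the integral basis `B`. -/
noncomputable def upperBoxDensity {ι R : Type*} [Fintype ι] [CommRing R]
    (B : Module.Basis ι ℤ R) {m : ℕ} (T : Set (Fin m → R)) : ℝ :=
  limsup (boxProportion B T) atTop

/-- Lower density of `T` with respect to the integral basis `B`. -/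
noncomputable def lowerBoxDensity {ι R : Type*} [Fintype ι] [CommRing R]
    (B : Module.Basis ι ℤ R) {m : ℕ} (T : Set (Fin m → R)) : ℝ :=
  liminf (boxProportion B T) atTop

/-- `T` has density `d` with respect to `B`: the upper and lower densities both equal `d`. -/
def HasBoxDensity {ι R : Type*} [Fintype ι] [CommRing R]
    (B : Module.Basis ι ℤ R) {m : ℕ} (T : Set (Fin m → R)) (d : ℝ) : Prop :=
  upperBoxDensity B T = d ∧ lowerBoxDensity B T = d

/-- The factor at `𝔭`, namely
`∑_{k=0}^m i_k(H) (1 - 1 / N(𝔭 ^ r)) ^ (m - k) (1 / N(𝔭 ^ r)) ^ k`. -/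
noncomputable def localDensity (K : Type*) [Field K] [NumberField K] {m : ℕ}
    (H : Hypergraph (Fin m)) (r : ℕ) (p : IsDedekindDomain.HeightOneSpectrum (𝓞 K)) : ℝ :=
  ∑ k ∈ Finset.range (m + 1), (H.numIndependent k : ℝ) *
    (1 - 1 / (Ideal.absNorm (p.asIdeal ^ r) : ℝ)) ^ (m - k) *
    (1 / (Ideal.absNorm (p.asIdeal ^ r) : ℝ)) ^ k

/-! Whether a tuple is bad at `𝔭` (all its entries on some edge lie in `𝔭 ^ r`) depends only on its
residues modulo `𝔭 ^ r`. For a finite set `S` of primes these residues are jointly surjective by the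
Chinese remainder theorem, and integer cubes are equidistributed in finite quotients, so the tuples
good at every prime of `S` have as density the product of the local proportions
(`tendsto_boxProportion_finset`). Sorting residue tuples by their zero set, which must be
independent, gives the stated local factor. All factors lie in `[0, 1]`, so the finite products
decrease to their infimum `P` and the upper density is at most `P`.

For the lower bound, the tuples bad at some prime outside `S` must be rare uniformly in `M`. If `𝔭 ^
r` has a nonzero element in the box, a packing argument based on the norm bounds its share of the
box by `C / N(𝔭 ^ r)`; otherwise the entries on the bad edge all vanish. Each edge has `j` vertices,
so the bad share is at most a constant times `1 / M` plus a constant times the sum of `1 / N(𝔭) ^ (r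
* j)` over `𝔭 ∉ S` (`exists_boxProportion_tail_le`), which is small for suitable `S` when `r * j ≥
2`.

If `r = j = 1` that series is unavailable. Then any edge is a single vertex, the local factors are
at most `1 - 1 / N(𝔭)`, and their product is `0` because `∑ 1 / N(I)` diverges. The upper bound
alone then suffices. -/

/-! ### Equidistribution of integer cubes in finite quotients -/

/-- The integer points of the half-open cube `[-M, M)^κ`. -/
noncomputable def intCube (κ : Type*) [Fintype κ] [DecidableEq κ] (M : ℕ) : Finset (κ → ℤ) :=
  Fintype.piFinset fun _ => Finset.Ico (-(M : ℤ)) M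

theorem mem_intCube {κ : Type*} [Fintype κ] [DecidableEq κ] {M : ℕ} {c : κ → ℤ} :
    c ∈ intCube κ M ↔ ∀ i, c i ∈ Set.Ico (-(M : ℤ)) M := by
  simp [intCube]

theorem card_intCube (κ : Type*) [Fintype κ] [DecidableEq κ] (M : ℕ) :
    (intCube κ M).card = (2 * M) ^ Fintype.card κ := by
  simp only [intCube, Fintype.card_piFinset, Int.card_Ico, Finset.prod_const, Finset.card_univ]
  congr 1
  lia

open scoped Classical in
theorem tendsto_card_Ico_residue {Q : ℕ} (hQ : 0 < Q) (a : ZMod Q) :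
    Tendsto (fun M : ℕ => (((Finset.Ico (-(M : ℤ)) M).filter
      (fun x : ℤ => (x : ZMod Q) = a)).card : ℝ) / (2 * M)) atTop (nhds (1 / Q)) := by
  have hQ' : (0 : ℚ) < Q := by exact_mod_cast hQ
  obtain ⟨v, rfl⟩ := ZMod.intCast_surjective a
  -- The count is a difference of two ceilings whose arguments differ by `2M / Q`, hence the error
  -- of at most `1`.
  have key : ∀ M : ℕ, |(((Finset.Ico (-(M : ℤ)) M).filter
      (fun x : ℤ => (x : ZMod Q) = v)).card : ℝ) - 2 * M / Q| ≤ 1 := by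
    intro M
    have h := Int.Ico_filter_modEq_card (-(M : ℤ)) M (r := (Q : ℤ)) (by exact_mod_cast hQ) v
    have h2 : ((Finset.Ico (-(M : ℤ)) M).filter (fun x : ℤ => (x : ZMod Q) = v)) =
        ((Finset.Ico (-(M : ℤ)) M).filter (fun x : ℤ => x ≡ v [ZMOD Q])) := by
      ext x
      simp [ZMod.intCast_eq_intCast_iff]
    rw [h2]
    have hle : ((-(M : ℤ) : ℤ) - v : ℚ) / ((Q : ℤ) : ℚ) ≤ ((M : ℤ) - v : ℚ) / ((Q : ℤ) : ℚ) := by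
      push_cast
      gcongr
      linarith [(Nat.cast_nonneg M : (0 : ℚ) ≤ M)]
    rw [max_eq_left (sub_nonneg.mpr (Int.ceil_le_ceil hle))] at h
    have a1 := Int.le_ceil (((M : ℤ) - v : ℚ) / ((Q : ℤ) : ℚ))
    have a2 := Int.ceil_lt_add_one (((M : ℤ) - v : ℚ) / ((Q : ℤ) : ℚ))
    have b1 := Int.le_ceil (((-(M : ℤ) : ℤ) - v : ℚ) / ((Q : ℤ) : ℚ))
    have b2 := Int.ceil_lt_add_one (((-(M : ℤ) : ℤ) - v : ℚ) / ((Q : ℤ) : ℚ))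
    have h' := congrArg (fun z : ℤ => (z : ℚ)) h
    rw [Int.cast_natCast, Int.cast_sub] at h'
    have hd : ((M : ℤ) - v : ℚ) / ((Q : ℤ) : ℚ) - ((-(M : ℤ) : ℤ) - v : ℚ) / ((Q : ℤ) : ℚ)
        = 2 * M / Q := by
      push_cast
      field_simp
      ring
    have : |((((Finset.Ico (-(M : ℤ)) M).filter
      (fun x : ℤ => x ≡ v [ZMOD Q])).card : ℚ)) - 2 * M / Q| ≤ 1 := by
      rw [h', ← hd, abs_le]
      constructor <;> linarith
    have h3 := (Rat.cast_le (K := ℝ)).mpr this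
    push_cast at h3
    exact h3
  rw [tendsto_iff_dist_tendsto_zero]
  refine squeeze_zero' (Eventually.of_forall fun _ => dist_nonneg) ?_
    (tendsto_const_nhds (x := (1 : ℝ)).div_atTop
      (tendsto_natCast_atTop_atTop.const_mul_atTop (zero_lt_two (α := ℝ))))
  filter_upwards [eventually_gt_atTop 0] with M hM
  have hM' : (0 : ℝ) < 2 * M := by positivity
  have hQr : (0 : ℝ) < Q := by exact_mod_cast hQ
  rw [Real.dist_eq, le_div_iff₀ hM', ← abs_of_pos hM', ← abs_mul, abs_of_pos hM']
  have h : ∀ x : ℝ, (x / (2 * M) - 1 / Q) * (2 * M) = x - 2 * M / Q := fun x => by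
    rw [sub_mul, div_mul_cancel₀ _ hM'.ne']
    ring
  rw [h]
  exact key M

open scoped Classical in
theorem tendsto_card_intCube_residue {κ : Type*} [Fintype κ] [DecidableEq κ] {Q : ℕ} (hQ : 0 < Q)
    (a : κ → ZMod Q) :
    Tendsto (fun M : ℕ => (((intCube κ M).filter
      (fun c => (fun i => (c i : ZMod Q)) = a)).card : ℝ) / (2 * M) ^ Fintype.card κ) atTop
      (nhds ((1 / Q) ^ Fintype.card κ)) := by
  have h := tendsto_finsetProd (Finset.univ : Finset κ)
    (fun i _ => tendsto_card_Ico_residue hQ (a i))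
  simp only [Finset.prod_div_distrib, Finset.prod_const, Finset.card_univ] at h
  rw [div_pow]
  refine h.congr fun M => ?_
  congr 1
  rw [← Nat.cast_prod, ← Fintype.card_piFinset]
  congr 2
  ext c
  simp [intCube, funext_iff, forall_and]

/-- The order of `G` annihilates `G`, so `φ` factors through reduction of the coordinates modulo
`Nat.card G`. -/
theorem map_eq_of_intCast_eq {κ G : Type*} [AddCommGroup G] [Finite G]
    (φ : (κ → ℤ) →+ G) {c d : κ → ℤ}
    (h : ∀ i, (c i : ZMod (Nat.card G)) = d i) : φ c = φ d := by
  have h1 : ∀ i, ∃ k : ℤ, c i - d i = Nat.card G * k := fun i => by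
    have := (ZMod.intCast_eq_intCast_iff_dvd_sub _ _ _).mp (h i).symm
    exact this
  choose k hk using h1
  have h2 : c - d = (Nat.card G) • k := by
    ext i
    simp [hk]
  rw [← sub_eq_zero, ← map_sub, h2, map_nsmul, card_nsmul_eq_zero']

open scoped Classical in
/-- Integer points of large cubes are equidistributed among the elements of any finite quotient. -/
theorem tendsto_card_intCube_filter {κ G : Type*} [Fintype κ] [DecidableEq κ] [AddCommGroup G] [Finite G]
    (φ : (κ → ℤ) →+ G) (hφ : Function.Surjective φ) (A : Set G) :
    Tendsto (fun M : ℕ => (((intCube κ M).filter (fun c => φ c ∈ A)).card : ℝ) /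
      (2 * M) ^ Fintype.card κ) atTop (nhds (A.ncard / Nat.card G)) := by
  set Q := Nat.card G with hQdef
  have hQ : 0 < Q := Nat.card_pos
  have : NeZero Q := ⟨hQ.ne'⟩
  have := Fintype.ofFinite G
  let l : (κ → ZMod Q) → κ → ℤ := fun a i => (a i).val
  have hl : ∀ a i, ((l a i : ℤ) : ZMod Q) = a i := fun a i => by simp [l]
  -- The factorization of `φ` through `(ZMod Q) ^ κ`, defined by lifting representatives; it is
  -- additive because `φ` does not see the choice of lift.
  let ψ : (κ → ZMod Q) →+ G := AddMonoidHom.mk' (fun a => φ (l a)) fun a b => by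
    rw [← map_add]
    exact map_eq_of_intCast_eq φ fun i => by
      rw [hl, Pi.add_apply, Pi.add_apply, Int.cast_add, hl, hl]
  have hψ : ∀ c : κ → ℤ, ψ (fun i => (c i : ZMod Q)) = φ c := fun c =>
    map_eq_of_intCast_eq φ fun i => hl (fun i => (c i : ZMod Q)) i
  have hψs : Function.Surjective ψ := fun g => by
    obtain ⟨c, rfl⟩ := hφ g
    exact ⟨_, hψ c⟩
  -- The fibres of a surjective homomorphism are equally large, so each has `Q ^ |κ| / Q` elements.
  have hfib : ∀ g : G, (Finset.univ.filter fun a => ψ a = g).card * Q = Q ^ Fintype.card κ := by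
    intro g
    have h1 : ∑ g' : G, (Finset.univ.filter fun a => ψ a = g').card = Q ^ Fintype.card κ := by
      rw [← Finset.card_eq_sum_card_fiberwise (s := Finset.univ) (f := ψ)
        (fun _ _ => Finset.mem_univ _), Finset.card_univ, Fintype.card_fun, ZMod.card]
    rw [← h1, Finset.sum_congr rfl fun g' _ =>
      AddMonoidHom.card_fiber_eq_of_mem_range ψ (hψs g') (hψs g), Finset.sum_const,
      Finset.card_univ, smul_eq_mul, mul_comm, ← Nat.card_eq_fintype_card]
  have hsum := tendsto_finsetSum (Finset.univ.filter fun a => ψ a ∈ A)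
    (fun a _ => tendsto_card_intCube_residue (κ := κ) hQ a)
  have hcard : ((Finset.univ.filter fun a => ψ a ∈ A).card : ℝ) * Q =
      A.ncard * Q ^ Fintype.card κ := by
    have : (Finset.univ.filter fun a => ψ a ∈ A).card =
        ∑ g ∈ A.toFinset, (Finset.univ.filter fun a => ψ a = g).card := by
      rw [Finset.card_eq_sum_card_fiberwise (f := ψ) (t := A.toFinset)
        (fun a ha => by simpa using ha)]
      refine Finset.sum_congr rfl fun g hg => ?_
      congr 1
      ext a
      simp only [Finset.mem_filter, Finset.mem_univ, true_and, and_iff_right_iff_imp]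
      rintro rfl
      simpa using hg
    have h2 : (Finset.univ.filter fun a => ψ a ∈ A).card * Q = A.ncard * Q ^ Fintype.card κ := by
      rw [this, Finset.sum_mul, Finset.sum_congr rfl fun g _ => hfib g, Finset.sum_const,
        smul_eq_mul, Set.ncard_eq_toFinset_card']
    exact_mod_cast h2
  have hQr : (Q : ℝ) ≠ 0 := by exact_mod_cast hQ.ne'
  rw [Finset.sum_const, nsmul_eq_mul] at hsum
  have hlim : (A.ncard : ℝ) / Q =
      ((Finset.univ.filter fun a => ψ a ∈ A).card : ℝ) * (1 / Q) ^ Fintype.card κ := by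
    rw [div_eq_iff hQr, mul_right_comm, hcard, mul_assoc, ← mul_pow]
    field_simp
    simp
  rw [hlim]
  refine hsum.congr fun M => ?_
  rw [← Finset.sum_div, ← Nat.cast_sum]
  congr 2
  rw [Finset.card_eq_sum_card_fiberwise (f := fun c : κ → ℤ => fun i => (c i : ZMod Q))
    (s := (intCube κ M).filter (fun c => φ c ∈ A)) (t := Finset.univ.filter fun a => ψ a ∈ A)
    (fun c hc => by
      have := (Finset.mem_filter.mp hc).2
      simpa [hψ] using this)]
  refine Finset.sum_congr rfl fun a ha => ?_
  congr 1
  ext c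
  simp only [Finset.mem_filter, and_assoc]
  refine and_congr_right fun _ => ?_
  constructor
  · rintro rfl
    refine ⟨?_, rfl⟩
    simpa [hψ] using ha
  · exact fun h => h.2

/-! ### Boxes in coordinates and elementary properties of proportions -/

section Box

variable {ι R : Type*} [Fintype ι] [CommRing R] (B : Module.Basis ι ℤ R)

/-- Tuples of elements of `R`, described by their coordinates with respect to `B`. -/
noncomputable def basisTuple (m : ℕ) : (Fin m × ι → ℤ) ≃+ (Fin m → R) where
  toFun c i := ∑ k, c (i, k) • B k
  invFun β ik := B.repr (β ik.1) ik.2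
  left_inv c := by
    ext ⟨i, k⟩
    exact congrFun (B.repr_sum_self fun k => c (i, k)) k
  right_inv β := by
    ext i
    exact B.sum_repr (β i)
  map_add' c d := by
    ext i
    simp [add_smul, Finset.sum_add_distrib]

open scoped Classical in
theorem basisTuple_mem_integralBoxPow {m M : ℕ} (c : Fin m × ι → ℤ) :
    basisTuple B m c ∈ integralBoxPow B m M ↔ c ∈ intCube (Fin m × ι) M := by
  simp only [integralBoxPow, integralBox, Set.mem_ofPred_eq, mem_intCube, Prod.forall]
  refine forall_congr' fun i => ⟨?_, fun h => ⟨fun k => c (i, k), h, rfl⟩⟩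
  rintro ⟨d, hd, hcd⟩ k
  have h : ∑ k, c (i, k) • B k = ∑ k, d k • B k := hcd
  have h' := congrArg (fun x => B.repr x k) h
  simp only [B.repr_sum_self (fun k => c (i, k)), B.repr_sum_self d] at h'
  exact h' ▸ hd k

open scoped Classical in
theorem ncard_inter_integralBoxPow {m : ℕ} (T : Set (Fin m → R)) (M : ℕ) :
    (T ∩ integralBoxPow B m M).ncard =
      ((intCube (Fin m × ι) M).filter (fun c => basisTuple B m c ∈ T)).card := by
  rw [← Set.ncard_coe_finset, ← Set.ncard_image_of_injective _ (basisTuple B m).injective]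
  congr 1
  ext β
  obtain ⟨c, rfl⟩ := (basisTuple B m).surjective β
  simp [basisTuple_mem_integralBoxPow, and_comm]

theorem finite_integralBoxPow (m M : ℕ) : (integralBoxPow B m M).Finite := by
  classical
  refine (((intCube (Fin m × ι) M).finite_toSet).image (basisTuple B m)).subset fun β hβ => ?_
  obtain ⟨c, rfl⟩ := (basisTuple B m).surjective β
  exact ⟨c, (basisTuple_mem_integralBoxPow B c).mp hβ, rfl⟩

theorem ncard_integralBoxPow (m M : ℕ) :
    (integralBoxPow B m M).ncard = (2 * M) ^ (m * Fintype.card ι) := by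
  classical
  have h := ncard_inter_integralBoxPow B (Set.univ : Set (Fin m → R)) M
  simpa [card_intCube] using h

open scoped Classical in
theorem boxProportion_eq {m : ℕ} (T : Set (Fin m → R)) (M : ℕ) :
    boxProportion B T M = (((intCube (Fin m × ι) M).filter
      (fun c => basisTuple B m c ∈ T)).card : ℝ) / (2 * M) ^ Fintype.card (Fin m × ι) := by
  rw [boxProportion, ncard_inter_integralBoxPow, ncard_integralBoxPow]
  simp

theorem boxProportion_nonneg {m : ℕ} (T : Set (Fin m → R)) (M : ℕ) :
    0 ≤ boxProportion B T M := by
  unfold boxProportion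
  positivity

theorem boxProportion_mono_of_inter {m : ℕ} {T U : Set (Fin m → R)} {M : ℕ}
    (h : T ∩ integralBoxPow B m M ⊆ U) : boxProportion B T M ≤ boxProportion B U M := by
  unfold boxProportion
  have := Set.ncard_le_ncard (Set.subset_inter h Set.inter_subset_right)
    ((finite_integralBoxPow B m M).inter_of_right U)
  gcongr

theorem boxProportion_mono {m : ℕ} {T U : Set (Fin m → R)} (h : T ⊆ U) (M : ℕ) :
    boxProportion B T M ≤ boxProportion B U M :=
  boxProportion_mono_of_inter B (Set.inter_subset_left.trans h)

theorem boxProportion_union_le {m : ℕ} (T U : Set (Fin m → R)) (M : ℕ) :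
    boxProportion B (T ∪ U) M ≤ boxProportion B T M + boxProportion B U M := by
  unfold boxProportion
  rw [← add_div, Set.union_inter_distrib_right]
  gcongr
  exact_mod_cast Set.ncard_union_le _ _

theorem boxProportion_biUnion_le {m : ℕ} {α : Type*} (s : Finset α) (T : α → Set (Fin m → R))
    (M : ℕ) : boxProportion B (⋃ a ∈ s, T a) M ≤ ∑ a ∈ s, boxProportion B (T a) M := by
  classical
  induction s using Finset.induction_on with
  | empty => simp [boxProportion]
  | insert a s ha ih =>
    rw [Finset.set_biUnion_insert, Finset.sum_insert ha]
    exact (boxProportion_union_le B _ _ M).trans (by gcongr)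

/-- The density of a set of tuples which is the preimage of a subset of a finite quotient. -/
theorem tendsto_boxProportion_preimage {m : ℕ} {G : Type*} [AddCommGroup G] [Finite G]
    (φ : (Fin m → R) →+ G) (hφ : Function.Surjective φ) (A : Set G) :
    Tendsto (boxProportion B (φ ⁻¹' A)) atTop (nhds (A.ncard / Nat.card G)) := by
  classical
  refine (tendsto_card_intCube_filter (φ.comp (basisTuple B m).toAddMonoidHom)
    (hφ.comp (basisTuple B m).surjective) A).congr fun M => ?_
  rw [boxProportion_eq]
  congr

end Box

/-! ### Counting residue tuples by their zero sets -/

section LocalCount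

open scoped Classical in
theorem Hypergraph.numIndependent_eq {m : ℕ} (H : Hypergraph (Fin m)) (k : ℕ) :
    H.numIndependent k =
      (Finset.univ.filter fun S : Finset (Fin m) => H.IsIndependent S ∧ S.card = k).card := by
  rw [Hypergraph.numIndependent, ← Set.ncard_coe_finset,
    ← Set.ncard_image_of_injective _ Finset.coe_injective]
  congr 1
  ext S
  obtain ⟨S, rfl⟩ := S.toFinite.exists_finset_coe
  simp [Set.ncard_coe_finset, and_comm]

/-- The proportion of tuples over a finite pointed set `X` such that no edge of `H` consists of
zeros only, in terms of the numbers of independent sets. -/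
theorem Hypergraph.ncard_not_zero_on_edges_div {m : ℕ} (H : Hypergraph (Fin m))
    (hH : H.vertexSet = Set.univ) (X : Type*) [Finite X] [Zero X] :
    (({x : Fin m → X | ∀ e ∈ H.edgeSet, ∃ i ∈ e, x i ≠ 0}.ncard : ℝ) / (Nat.card X : ℝ) ^ m) =
    ∑ k ∈ Finset.range (m + 1), (H.numIndependent k : ℝ) * (1 - 1 / (Nat.card X : ℝ)) ^ (m - k) *
      (1 / (Nat.card X : ℝ)) ^ k := by
  classical
  have := Fintype.ofFinite X
  have hq : 0 < Nat.card X := Nat.card_pos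
  set q := Nat.card X with hqdef
  have hq' : (q : ℝ) ≠ 0 := by exact_mod_cast hq.ne'
  -- No edge is entirely zero exactly when the zero set `Z x` is independent; a given zero set `S`
  -- leaves `q - 1` choices at each of the other `m - |S|` vertices.
  let Z : (Fin m → X) → Finset (Fin m) := fun x => Finset.univ.filter fun i => x i = 0
  have hZ : ∀ S : Finset (Fin m),
      (((Finset.univ.filter fun x => Z x = S).card : ℕ) : ℝ) = ((q : ℝ) - 1) ^ (m - S.card) := by
    intro S
    have h1 : (Finset.univ.filter fun x => Z x = S) =
        Fintype.piFinset fun i => if i ∈ S then {(0 : X)} else Finset.univ.erase 0 := by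
      ext x
      simp only [Finset.mem_filter, Finset.mem_univ, true_and, Fintype.mem_piFinset, Z,
        Finset.ext_iff]
      refine forall_congr' fun i => ?_
      by_cases hi : i ∈ S <;> simp [hi]
    have h2 : ∀ i, (if i ∈ S then {(0 : X)} else Finset.univ.erase 0).card =
        if i ∈ S then 1 else q - 1 := fun i => by
      by_cases hi : i ∈ S
      · simp [hi]
      · simp [hi, hqdef, Nat.card_eq_fintype_card]
    rw [h1, Fintype.card_piFinset, Finset.prod_congr rfl fun i _ => h2 i, Finset.prod_ite]
    simp only [Finset.prod_const_one, one_mul, Finset.prod_const]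
    rw [Nat.cast_pow, Nat.cast_sub (Nat.one_le_iff_ne_zero.mpr hq.ne'), Nat.cast_one]
    congr 1
    rw [show (Finset.univ.filter fun i => i ∉ S) = Sᶜ by ext; simp, Finset.card_compl,
      Fintype.card_fin]
  have hind : ∀ x : Fin m → X, (∀ e ∈ H.edgeSet, ∃ i ∈ e, x i ≠ 0) ↔ H.IsIndependent (Z x) := by
    intro x
    simp only [Hypergraph.IsIndependent, hH, Set.subset_univ, true_and, Set.not_subset]
    simp [Z]
  have hA : ({x : Fin m → X | ∀ e ∈ H.edgeSet, ∃ i ∈ e, x i ≠ 0}.ncard : ℝ) =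
      ∑ S ∈ Finset.univ.filter fun S : Finset (Fin m) => H.IsIndependent S,
        ((q : ℝ) - 1) ^ (m - S.card) := by
    have h1 : {x : Fin m → X | ∀ e ∈ H.edgeSet, ∃ i ∈ e, x i ≠ 0} =
        ((Finset.univ.filter fun x => H.IsIndependent (Z x) : Finset (Fin m → X)) :
          Set (Fin m → X)) := by
      ext x
      simp [hind]
    rw [h1, Set.ncard_coe_finset, Finset.card_eq_sum_card_fiberwise (f := Z)
      (t := Finset.univ.filter fun S : Finset (Fin m) => H.IsIndependent S)
      (fun x hx => by simpa using hx), Nat.cast_sum]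
    refine Finset.sum_congr rfl fun S hS => ?_
    rw [← hZ S]
    congr 2
    ext x
    simp only [Finset.mem_filter, Finset.mem_univ, true_and, and_iff_right_iff_imp]
    rintro rfl
    simpa using hS
  rw [hA, Finset.sum_div, ← Finset.sum_fiberwise_of_maps_to (g := Finset.card)
    (t := Finset.range (m + 1)) (fun S _ => by
      simpa [Nat.lt_succ_iff] using Finset.card_le_univ S)]
  refine Finset.sum_congr rfl fun k hk => ?_
  have hkm : k ≤ m := Nat.lt_succ_iff.mp (Finset.mem_range.mp hk)
  rw [Finset.filter_filter, Finset.sum_congr rfl (g := fun _ => ((q : ℝ) - 1) ^ (m - k) / q ^ m)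
    (fun S hS => by rw [(Finset.mem_filter.mp hS).2.2]), Finset.sum_const, nsmul_eq_mul,
    H.numIndependent_eq k, mul_assoc]
  congr 1
  rw [one_sub_div hq', div_pow, div_pow, one_pow, div_mul_div_comm, mul_one, ← pow_add,
    Nat.sub_add_cancel hkm]

end LocalCount

/-! ### Local densities and finitely many primes -/

section NumberFieldSieve

variable {K : Type*} [Field K] [NumberField K]

open IsDedekindDomain

instance finite_quotient_height_one_pow (p : HeightOneSpectrum (𝓞 K)) (r : ℕ) :
    Finite (𝓞 K ⧸ p.asIdeal ^ r) :=
  Ideal.finiteQuotientOfFreeOfNeBot _ (pow_ne_zero r p.ne_bot)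

theorem absNorm_height_one_pos (p : HeightOneSpectrum (𝓞 K)) : 0 < Ideal.absNorm p.asIdeal :=
  Nat.pos_of_ne_zero fun h => p.ne_bot (Ideal.absNorm_eq_zero_iff.mp h)

theorem card_quotient_eq_absNorm (I : Ideal (𝓞 K)) : Nat.card (𝓞 K ⧸ I) = Ideal.absNorm I := by
  rw [Ideal.absNorm_apply, Submodule.cardQuot_apply]

/-- This reading of the factor as a proportion of residue tuples makes its bounds evident and
matches it with the output of equidistribution. -/
theorem localDensity_eq {m : ℕ} (H : Hypergraph (Fin m)) (hH : H.vertexSet = Set.univ) (r : ℕ)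
    (p : HeightOneSpectrum (𝓞 K)) :
    localDensity K H r p =
      ({x : Fin m → 𝓞 K ⧸ p.asIdeal ^ r | ∀ e ∈ H.edgeSet, ∃ i ∈ e, x i ≠ 0}.ncard : ℝ) /
        (Nat.card (𝓞 K ⧸ p.asIdeal ^ r) : ℝ) ^ m := by
  rw [H.ncard_not_zero_on_edges_div hH, card_quotient_eq_absNorm, localDensity]

theorem localDensity_nonneg {m : ℕ} (H : Hypergraph (Fin m)) (hH : H.vertexSet = Set.univ)
    (r : ℕ) (p : HeightOneSpectrum (𝓞 K)) : 0 ≤ localDensity K H r p := by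
  rw [localDensity_eq H hH]
  positivity

theorem localDensity_le_one {m : ℕ} (H : Hypergraph (Fin m)) (hH : H.vertexSet = Set.univ)
    (r : ℕ) (p : HeightOneSpectrum (𝓞 K)) : localDensity K H r p ≤ 1 := by
  rw [localDensity_eq H hH]
  refine div_le_one_of_le₀ ?_ (by positivity)
  have h := Set.ncard_le_ncard (Set.subset_univ
    {x : Fin m → 𝓞 K ⧸ p.asIdeal ^ r | ∀ e ∈ H.edgeSet, ∃ i ∈ e, x i ≠ 0})
  rw [Set.ncard_univ, Nat.card_fun, Nat.card_eq_fintype_card (α := Fin m), Fintype.card_fin] at h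
  exact_mod_cast h

/-- If some vertex is an edge, the local density is at most that of the elements not divisible by
`𝔭 ^ r`. -/
theorem localDensity_le_of_singleton_mem {m : ℕ} (H : Hypergraph (Fin m))
    (hH : H.vertexSet = Set.univ) (r : ℕ) (p : HeightOneSpectrum (𝓞 K)) {i : Fin m}
    (hi : {i} ∈ H.edgeSet) :
    localDensity K H r p ≤ 1 - 1 / (Ideal.absNorm (p.asIdeal ^ r) : ℝ) := by
  classical
  have := Fintype.ofFinite (𝓞 K ⧸ p.asIdeal ^ r)
  have hcard : Fintype.card (𝓞 K ⧸ p.asIdeal ^ r) = Ideal.absNorm (p.asIdeal ^ r) := by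
    rw [← card_quotient_eq_absNorm, Nat.card_eq_fintype_card]
  have hpos : 0 < Ideal.absNorm (p.asIdeal ^ r) := hcard ▸ Fintype.card_pos
  rw [localDensity_eq H hH, card_quotient_eq_absNorm]
  set q := Ideal.absNorm (p.asIdeal ^ r)
  have hq : (0 : ℝ) < q := by exact_mod_cast hpos
  have h1 : {x : Fin m → 𝓞 K ⧸ p.asIdeal ^ r | ∀ e ∈ H.edgeSet, ∃ i ∈ e, x i ≠ 0} ⊆
      ((Fintype.piFinset fun k : Fin m => if k = i then Finset.univ.erase 0 else Finset.univ :
        Finset (Fin m → 𝓞 K ⧸ p.asIdeal ^ r)) : Set (Fin m → 𝓞 K ⧸ p.asIdeal ^ r)) := by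
    intro x hx
    obtain ⟨k, rfl, hk⟩ := hx _ hi
    simp only [Finset.mem_coe, Fintype.mem_piFinset]
    intro l
    by_cases hl : l = k
    · subst hl; simpa using hk
    · simp [hl]
  have h2 := Set.ncard_le_ncard h1 (Finset.finite_toSet _)
  rw [Set.ncard_coe_finset, Fintype.card_piFinset,
    ← Finset.mul_prod_erase _ _ (Finset.mem_univ i), if_pos rfl,
    Finset.card_erase_of_mem (Finset.mem_univ _), Finset.card_univ, hcard,
    Finset.prod_congr rfl (g := fun _ => q) (fun k hk => by
      rw [if_neg (Finset.ne_of_mem_erase hk), Finset.card_univ, hcard]), Finset.prod_const,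
    Finset.card_erase_of_mem (Finset.mem_univ _), Finset.card_univ, Fintype.card_fin] at h2
  have hm : 0 < m := i.pos
  rw [div_le_iff₀ (by positivity)]
  calc (_ : ℝ) ≤ ((q - 1) * q ^ (m - 1) : ℕ) := by exact_mod_cast h2
    _ = (q - 1) * q ^ (m - 1) := by
      rw [Nat.cast_mul, Nat.cast_sub (Nat.one_le_iff_ne_zero.mpr hpos.ne')]
      simp
    _ = (1 - 1 / (q : ℝ)) * q ^ m := by
      obtain ⟨k, rfl⟩ := Nat.exists_eq_succ_of_ne_zero hm.ne'
      simp only [Nat.succ_eq_add_one, Nat.add_sub_cancel, pow_succ]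
      field_simp

/-- The tuples satisfying the local conditions at all primes of a finite set have the expected
density. -/
theorem tendsto_boxProportion_finset {m : ℕ} (H : Hypergraph (Fin m))
    (hH : H.vertexSet = Set.univ) (r : ℕ) {ι : Type*} [Fintype ι] (B : Module.Basis ι ℤ (𝓞 K))
    (S : Finset (HeightOneSpectrum (𝓞 K))) :
    Tendsto (boxProportion B {β : Fin m → 𝓞 K |
      ∀ p ∈ S, ∀ e ∈ H.edgeSet, ∃ i ∈ e, β i ∉ p.asIdeal ^ r}) atTop
      (nhds (∏ p ∈ S, localDensity K H r p)) := by
  classical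
  let φ : (Fin m → 𝓞 K) →+ ((p : S) → Fin m → 𝓞 K ⧸ p.1.asIdeal ^ r) :=
    AddMonoidHom.mk' (fun β p i => Ideal.Quotient.mk _ (β i)) fun a b => by
      ext p i
      simp
  have hφ : Function.Surjective φ := by
    intro x
    -- Distinct nonzero primes are maximal, so their powers are coprime and the Chinese remainder
    -- theorem applies to each coordinate separately.
    have hco : Pairwise (Function.onFun IsCoprime fun p : S => p.1.asIdeal ^ r) := by
      intro p p' hpp'
      refine IsCoprime.pow ?_
      have := p.1.isMaximal
      have := p'.1.isMaximal
      exact Ideal.isCoprime_of_isMaximal fun h => hpp' (Subtype.ext (HeightOneSpectrum.ext h))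
    have h := fun i : Fin m => Ideal.pi_quotient_surjective hco fun p => x p i
    choose y hy using h
    exact ⟨y, by ext p i; exact hy i p⟩
  have h := tendsto_boxProportion_preimage B φ hφ (Set.pi Set.univ fun p : S =>
    {x : Fin m → 𝓞 K ⧸ p.1.asIdeal ^ r | ∀ e ∈ H.edgeSet, ∃ i ∈ e, x i ≠ 0})
  convert h using 2
  · ext β
    simp [φ, Set.mem_pi, Ideal.Quotient.eq_zero_iff_mem]
  · rw [Nat.card_pi, ← Finset.prod_coe_sort, Nat.cast_prod, Set.ncard_def,
      Set.encard_pi_eq_prod_encard, ENat.toNat_prod, Nat.cast_prod,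
      ← Finset.prod_div_distrib]
    refine Finset.prod_congr rfl fun p _ => ?_
    rw [localDensity_eq H hH, Nat.card_fun, Nat.card_eq_fintype_card (α := Fin m),
      Fintype.card_fin, Nat.cast_pow, Set.ncard_def]

end NumberFieldSieve

theorem Set.ncard_pi_univ {α : Type*} [Fintype α] {X : α → Type*} (s : ∀ a, Set (X a)) :
    (Set.pi Set.univ s).ncard = ∏ a, (s a).ncard := by
  rw [Set.ncard_def, Set.encard_pi_eq_prod_encard, ENat.toNat_prod]
  rfl

/-! ### Norm bounds and packing for ideals in a box -/

section IntegralBox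

variable {ι R : Type*} [Fintype ι] [CommRing R] (B : Module.Basis ι ℤ R)

theorem mem_integralBox_iff {M : ℕ} {x : R} :
    x ∈ integralBox B M ↔ ∀ k, B.repr x k ∈ Set.Ico (-(M : ℤ)) M := by
  constructor
  · rintro ⟨c, hc, rfl⟩ k
    rw [B.repr_sum_self]
    exact hc k
  · exact fun h => ⟨_, h, (B.sum_repr x).symm⟩

theorem integralBoxPow_eq_pi (m M : ℕ) :
    integralBoxPow B m M = Set.pi Set.univ fun _ : Fin m => integralBox B M := by
  ext β
  simp [integralBoxPow]

theorem ncard_integralBox (M : ℕ) : (integralBox B M).ncard = (2 * M) ^ Fintype.card ι := by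
  have h := ncard_integralBoxPow B 1 M
  rwa [integralBoxPow_eq_pi, Set.ncard_pi_univ, Fin.prod_univ_one, one_mul] at h

theorem finite_integralBox (M : ℕ) : (integralBox B M).Finite := by
  have h := finite_integralBoxPow B 1 M
  rw [integralBoxPow_eq_pi] at h
  refine (h.image fun β => β 0).subset fun x hx => ⟨fun _ => x, ?_, rfl⟩
  exact fun _ _ => hx

theorem abs_repr_le_of_mem_integralBox {M : ℕ} {x : R} (hx : x ∈ integralBox B M) (k : ι) :
    |(B.repr x k : ℝ)| ≤ M := by
  obtain ⟨h1, h2⟩ := (mem_integralBox_iff B).mp hx k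
  rw [abs_le]
  exact ⟨by exact_mod_cast h1, by exact_mod_cast h2.le⟩

/-- The box is a product, so the conditions at the vertices of `e` are independent. This yields the
exponent `e.ncard` on which the convergence of the tail rests. -/
theorem boxProportion_forall_mem {m : ℕ} (I : Set R) (e : Set (Fin m)) {M : ℕ} (hM : 0 < M) :
    boxProportion B {β : Fin m → R | ∀ i ∈ e, β i ∈ I} M =
      (((I ∩ integralBox B M).ncard : ℝ) / (2 * M) ^ Fintype.card ι) ^ e.ncard := by
  classical
  have h1 : {β : Fin m → R | ∀ i ∈ e, β i ∈ I} ∩ integralBoxPow B m M =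
      Set.pi Set.univ fun i => if i ∈ e then I ∩ integralBox B M else integralBox B M := by
    ext β
    simp only [integralBoxPow, Set.mem_inter_iff, Set.mem_ofPred_eq, Set.mem_pi, Set.mem_univ,
      forall_const, ← forall_and]
    refine forall_congr' fun i => ?_
    by_cases hi : i ∈ e <;> simp [hi]
  have h2 : ∀ i, (((if i ∈ e then I ∩ integralBox B M else integralBox B M).ncard : ℕ) : ℝ) /
      (integralBox B M).ncard =
      if i ∈ e then ((I ∩ integralBox B M).ncard : ℝ) / (2 * M) ^ Fintype.card ι else 1 := by
    intro i
    have h0 : ((integralBox B M).ncard : ℝ) = (2 * M) ^ Fintype.card ι := by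
      rw [ncard_integralBox]; push_cast; rfl
    by_cases hi : i ∈ e
    · simp [hi, h0]
    · simp only [hi, if_false]
      exact div_self (by rw [h0]; positivity)
  rw [boxProportion, h1, integralBoxPow_eq_pi, Set.ncard_pi_univ, Set.ncard_pi_univ, Nat.cast_prod,
    Nat.cast_prod, ← Finset.prod_div_distrib, Finset.prod_congr rfl fun i _ => h2 i,
    Finset.prod_ite]
  rw [Finset.prod_const_one, mul_one, Finset.prod_const, ← Set.ncard_coe_finset]
  simp

/-- The norm is bounded by a homogeneous function of the coordinates. -/
theorem exists_abs_norm_le : ∃ C : ℝ, 0 < C ∧ ∀ (x : R) (L : ℝ),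
    (∀ k, |(B.repr x k : ℝ)| ≤ L) → |(Algebra.norm ℤ x : ℝ)| ≤ C * L ^ Fintype.card ι := by
  classical
  -- The norm is the determinant of multiplication by `x`, whose matrix is linear in the
  -- coordinates. `D` bounds every entry of the basis matrices, and `D + 1` keeps the constant
  -- positive.
  let D : ℝ := ∑ k, ∑ i, ∑ j, |(Algebra.leftMulMatrix B (B k) i j : ℝ)|
  have hD : 0 ≤ D := by positivity
  refine ⟨(Fintype.card ι).factorial * (D + 1) ^ Fintype.card ι, by positivity, fun x L hL => ?_⟩
  have hentry : ∀ i j, |((Algebra.leftMulMatrix B x).map (Int.castRingHom ℝ)) i j| ≤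
      (D + 1) * L := by
    intro i j
    have hL0 : 0 ≤ L := (abs_nonneg _).trans (hL i)
    have hx : Algebra.leftMulMatrix B x i j =
        ∑ k, B.repr x k * Algebra.leftMulMatrix B (B k) i j := by
      conv_lhs => rw [← B.sum_repr x]
      simp only [map_sum, map_zsmul, Matrix.sum_apply, Matrix.smul_apply, smul_eq_mul]
    rw [Matrix.map_apply, hx]
    simp only [eq_intCast, Int.cast_sum, Int.cast_mul]
    calc |∑ k, (B.repr x k : ℝ) * (Algebra.leftMulMatrix B (B k) i j : ℝ)|
        ≤ ∑ k, L * |(Algebra.leftMulMatrix B (B k) i j : ℝ)| := by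
          refine (Finset.abs_sum_le_sum_abs _ _).trans (Finset.sum_le_sum fun k _ => ?_)
          rw [abs_mul]
          exact mul_le_mul_of_nonneg_right (hL k) (abs_nonneg _)
      _ ≤ ∑ k, L * ∑ i, ∑ j, |(Algebra.leftMulMatrix B (B k) i j : ℝ)| := by
          gcongr with k
          refine le_trans ?_ (Finset.single_le_sum
            (f := fun i => ∑ j, |(Algebra.leftMulMatrix B (B k) i j : ℝ)|)
            (fun i _ => by positivity) (Finset.mem_univ i))
          exact Finset.single_le_sum (f := fun j => |(Algebra.leftMulMatrix B (B k) i j : ℝ)|)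
            (fun j _ => by positivity) (Finset.mem_univ j)
      _ = D * L := by rw [← Finset.mul_sum, mul_comm]
      _ ≤ (D + 1) * L := by gcongr; linarith
  have h := Matrix.det_le (abv := AbsoluteValue.abs) hentry
  rw [← RingHom.mapMatrix_apply, ← RingHom.map_det, ← Algebra.norm_eq_matrix_det] at h
  simpa [mul_pow, mul_assoc] using h

variable [IsDedekindDomain R] [Module.Free ℤ R] [Module.Finite ℤ R]

/-- Packing bound: an ideal has at most one element in a cube of side `δ` if its norm is large
compared with `δ`. -/
theorem ncard_ideal_inter_integralBox_le {C : ℝ}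
    (hC : ∀ (x : R) (L : ℝ), (∀ k, |(B.repr x k : ℝ)| ≤ L) →
      |(Algebra.norm ℤ x : ℝ)| ≤ C * L ^ Fintype.card ι)
    (I : Ideal R) {δ : ℝ} (hδ : 0 < δ) (hN : C * δ ^ Fintype.card ι < Ideal.absNorm I) (M : ℕ) :
    (((I : Set R) ∩ integralBox B M).ncard : ℝ) ≤ (2 * M / δ + 2) ^ Fintype.card ι := by
  classical
  -- Index of the cell of side `δ` containing `x`. Two ideal elements in one cell differ by an
  -- element whose norm is a multiple of `absNorm I` but smaller in absolute value, hence zero.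
  let f : R → ι → ℤ := fun x k => ⌊(B.repr x k : ℝ) / δ⌋
  have hinj : Set.InjOn f ((I : Set R) ∩ integralBox B M) := by
    rintro x ⟨hx, -⟩ y ⟨hy, -⟩ hxy
    have hle : |(Algebra.norm ℤ (x - y) : ℝ)| ≤ C * δ ^ Fintype.card ι := by
      refine hC _ _ fun k => ?_
      have h := Int.abs_sub_lt_one_of_floor_eq_floor (congrFun hxy k)
      rw [← sub_div, abs_div, abs_of_pos hδ, div_lt_one hδ] at h
      simpa using h.le
    have hdvd : (Ideal.absNorm I : ℤ) ∣ Algebra.norm ℤ (x - y) :=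
      Ideal.absNorm_dvd_norm_of_mem (I.sub_mem hx hy)
    have hlt : |Algebra.norm ℤ (x - y)| < (Ideal.absNorm I : ℤ) := by
      exact_mod_cast hle.trans_lt hN
    have h0 := Int.eq_zero_of_abs_lt_dvd hdvd hlt
    exact sub_eq_zero.mp (Algebra.norm_eq_zero_iff.mp h0)
  have hmaps : f '' ((I : Set R) ∩ integralBox B M) ⊆
      ((Fintype.piFinset fun _ : ι => Finset.Icc ⌊-(M : ℝ) / δ⌋ ⌊(M : ℝ) / δ⌋ :
        Finset (ι → ℤ)) : Set (ι → ℤ)) := by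
    rintro _ ⟨x, ⟨-, hx⟩, rfl⟩
    simp only [Finset.mem_coe, Fintype.mem_piFinset, Finset.mem_Icc, f]
    intro k
    have h := abs_le.mp (abs_repr_le_of_mem_integralBox B hx k)
    exact ⟨Int.floor_le_floor (by gcongr; exact h.1), Int.floor_le_floor (by gcongr; exact h.2)⟩
  have hcard := Set.ncard_le_ncard hmaps (Finset.finite_toSet _)
  rw [hinj.ncard_image, Set.ncard_coe_finset, Fintype.card_piFinset,
    Finset.prod_const, Finset.card_univ, Int.card_Icc] at hcard
  have hM0 : (0 : ℝ) ≤ M / δ := by positivity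
  have hle : ⌊-(M : ℝ) / δ⌋ ≤ ⌊(M : ℝ) / δ⌋ := Int.floor_le_floor (by rw [neg_div]; linarith)
  have hside : ((⌊(M : ℝ) / δ⌋ + 1 - ⌊-(M : ℝ) / δ⌋).toNat : ℝ) ≤ 2 * M / δ + 2 := by
    have h1 : (((⌊(M : ℝ) / δ⌋ + 1 - ⌊-(M : ℝ) / δ⌋).toNat : ℤ) : ℝ) =
        ⌊(M : ℝ) / δ⌋ + 1 - ⌊-(M : ℝ) / δ⌋ := by
      rw [Int.toNat_of_nonneg (by linarith)]
      push_cast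
      ring
    rw [Int.cast_natCast] at h1
    rw [h1]
    have h2 := Int.floor_le ((M : ℝ) / δ)
    have h3 := Int.lt_floor_add_one (-(M : ℝ) / δ)
    rw [neg_div] at h3 ⊢
    have h4 : 2 * (M : ℝ) / δ = M / δ + M / δ := by ring
    linarith
  calc (((I : Set R) ∩ integralBox B M).ncard : ℝ)
      ≤ (((⌊(M : ℝ) / δ⌋ + 1 - ⌊-(M : ℝ) / δ⌋).toNat ^ Fintype.card ι : ℕ) : ℝ) := by
        exact_mod_cast hcard
    _ ≤ _ := by
        push_cast
        gcongr

/-- If an ideal has a nonzero element in a box, then it contains at most a multiple of the expected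
number of elements of the box. -/
theorem exists_ncard_ideal_inter_integralBox_le [Nonempty ι] : ∃ C : ℝ, 1 ≤ C ∧
    ∀ (I : Ideal R) (M : ℕ), (∃ x ∈ (I : Set R) ∩ integralBox B M, x ≠ 0) →
      (((I : Set R) ∩ integralBox B M).ncard : ℝ) / (2 * M) ^ Fintype.card ι ≤
        C / Ideal.absNorm I := by
  obtain ⟨C, hC0, hC⟩ := exists_abs_norm_le B
  have hn : Fintype.card ι ≠ 0 := Fintype.card_ne_zero
  set n := Fintype.card ι
  refine ⟨max 1 (2 ^ n * (2 * C)), le_max_left _ _, fun I M => ?_⟩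
  rintro ⟨x, ⟨hxI, hxM⟩, hx0⟩
  have hnorm : Algebra.norm ℤ x ≠ 0 := Algebra.norm_ne_zero_iff.mpr hx0
  have hdvd : (Ideal.absNorm I : ℤ) ∣ Algebra.norm ℤ x := Ideal.absNorm_dvd_norm_of_mem hxI
  have hNpos : 0 < Ideal.absNorm I := by
    rcases Nat.eq_zero_or_pos (Ideal.absNorm I) with h | h
    · rw [h, Nat.cast_zero, zero_dvd_iff] at hdvd
      exact absurd hdvd hnorm
    · exact h
  -- The nonzero element is used here: its norm is a nonzero multiple of `absNorm I`, so the box is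
  -- not too small for `I`.
  have hNle : (Ideal.absNorm I : ℝ) ≤ C * (M : ℝ) ^ n := by
    refine le_trans ?_ (hC x M (abs_repr_le_of_mem_integralBox B hxM))
    exact_mod_cast Int.le_of_dvd (abs_pos.mpr hnorm) ((dvd_abs _ _).mpr hdvd)
  set N : ℝ := ((Ideal.absNorm I : ℕ) : ℝ)
  have hN : 0 < N := Nat.cast_pos.mpr hNpos
  -- Chosen so that `C * δ ^ n = N / 2 < N`, as packing requires. Then `δ ≤ M`, so the rounding term
  -- `2` is absorbed by `2 * M / δ`.
  set δ : ℝ := (N / (2 * C)) ^ ((n : ℝ)⁻¹) with hδdef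
  have hδ : 0 < δ := by positivity
  have hδn : δ ^ n = N / (2 * C) := Real.rpow_inv_natCast_pow (by positivity) hn
  have hM0 : (0 : ℝ) ≤ M := Nat.cast_nonneg M
  have hδM : δ ≤ M := by
    refine le_of_pow_le_pow_left₀ hn hM0 ?_
    rw [hδn, div_le_iff₀ (by positivity)]
    nlinarith [pow_nonneg hM0 n]
  have hMpos : (0 : ℝ) < M := hδ.trans_le hδM
  have hpack := ncard_ideal_inter_integralBox_le B hC I hδ (by
    change C * δ ^ n < N
    rw [hδn]
    field_simp
    linarith) M
  rw [div_le_iff₀ (by positivity)]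
  calc (((I : Set R) ∩ integralBox B M).ncard : ℝ) ≤ (2 * M / δ + 2) ^ n := hpack
    _ ≤ (2 * M / δ + 2 * M / δ) ^ n := by
        gcongr
        rw [le_div_iff₀ hδ]
        linarith
    _ = (2 ^ n * (2 * C)) / N * (2 * M) ^ n := by
        rw [← two_mul, mul_div_assoc', div_pow, hδn, mul_pow]
        field_simp
    _ ≤ _ := by
        gcongr
        exact le_max_right _ _

end IntegralBox

/-! ### The contribution of large primes -/

section Tail

variable {K : Type*} [Field K] [NumberField K]

open IsDedekindDomain

/-- Large primes whose `r`-th power divides all entries at the vertices of `e` contribute little. -/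
theorem exists_boxProportion_tail_le {m r : ℕ} {ι : Type*} [Fintype ι] [Nonempty ι]
    (B : Module.Basis ι ℤ (𝓞 K)) {e : Set (Fin m)} (hre : 2 ≤ r * e.ncard) :
    ∃ C : ℝ, 0 < C ∧ ∀ (S : Finset (HeightOneSpectrum (𝓞 K))) (ε : ℝ),
      (∀ F : Finset (HeightOneSpectrum (𝓞 K)), Disjoint F S →
        ∑ p ∈ F, 1 / (Ideal.absNorm p.asIdeal : ℝ) ^ 2 ≤ ε) → ∀ M : ℕ, 0 < M →
      boxProportion B {β : Fin m → 𝓞 K | ∃ p ∉ S, ∀ i ∈ e, β i ∈ p.asIdeal ^ r} M ≤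
        1 / (2 * M) + C * ε := by
  classical
  obtain ⟨C, hC1, hC⟩ := exists_ncard_ideal_inter_integralBox_le B
  have hC0 : 0 < C := by linarith
  have hr : r ≠ 0 := by rintro rfl; simp at hre
  have he : e.ncard ≠ 0 := by intro h; simp [h] at hre
  refine ⟨C ^ e.ncard, by positivity, fun S ε hε M hM => ?_⟩
  have hMr : (1 : ℝ) ≤ M := by exact_mod_cast hM
  -- The primes that can affect a tuple whose entries on `e` are not all zero. Finitely many: such a
  -- box contains at least one point of `𝔭 ^ r`, so the packing bound forces `N(𝔭 ^ r) ≤ C * (2 * M)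
  -- ^ n`.
  let good : Set (HeightOneSpectrum (𝓞 K)) := {p | p ∉ S ∧
    ∃ x ∈ ((p.asIdeal ^ r : Ideal (𝓞 K)) : Set (𝓞 K)) ∩ integralBox B M, x ≠ 0}
  have hgood : good.Finite := by
    have hinj : Function.Injective fun p : HeightOneSpectrum (𝓞 K) => p.asIdeal :=
      fun p q h => HeightOneSpectrum.ext h
    refine ((Ideal.finite_setOfPred_absNorm_le (S := 𝓞 K) ⌊C * (2 * M) ^ Fintype.card ι⌋₊).preimage
      hinj.injOn).subset fun p hp => ?_
    obtain ⟨-, hx⟩ := hp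
    have h1 := hC _ M hx
    obtain ⟨x, hx, -⟩ := hx
    have hNpos := absNorm_height_one_pos p
    have hNr : (0 : ℝ) < Ideal.absNorm (p.asIdeal ^ r) := by
      rw [map_pow]; exact_mod_cast pow_pos hNpos r
    have hcard : (1 : ℝ) ≤
        (((p.asIdeal ^ r : Ideal (𝓞 K)) : Set (𝓞 K)) ∩ integralBox B M).ncard := by
      exact_mod_cast (Set.ncard_pos ((finite_integralBox B M).inter_of_right _)).mpr ⟨x, hx⟩
    rw [div_le_div_iff₀ (by positivity) hNr] at h1
    refine Nat.le_floor ?_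
    calc (Ideal.absNorm p.asIdeal : ℝ) ≤ Ideal.absNorm (p.asIdeal ^ r) := by
          rw [map_pow]; exact_mod_cast Nat.le_self_pow hr _
      _ ≤ _ := le_trans (by nlinarith) h1
  let T : HeightOneSpectrum (𝓞 K) → Set (Fin m → 𝓞 K) :=
    fun p => {β | ∀ i ∈ e, β i ∈ ((p.asIdeal ^ r : Ideal (𝓞 K)) : Set (𝓞 K))}
  have hsub : {β : Fin m → 𝓞 K | ∃ p ∉ S, ∀ i ∈ e, β i ∈ p.asIdeal ^ r} ∩ integralBoxPow B m M ⊆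
      {β : Fin m → 𝓞 K | ∀ i ∈ e, β i ∈ ({0} : Set (𝓞 K))} ∪ ⋃ p ∈ hgood.toFinset, T p := by
    rintro β ⟨⟨p, hpS, hp⟩, hβ⟩
    by_cases h0 : ∀ i ∈ e, β i = 0
    · exact Or.inl h0
    · push Not at h0
      obtain ⟨i, hi, hi0⟩ := h0
      refine Or.inr ?_
      simp only [Set.mem_iUnion, Set.Finite.mem_toFinset]
      exact ⟨p, ⟨hpS, β i, ⟨hp i hi, hβ i⟩, hi0⟩, hp⟩
  have hzero : boxProportion B {β : Fin m → 𝓞 K | ∀ i ∈ e, β i ∈ ({0} : Set (𝓞 K))} M ≤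
      1 / (2 * M) := by
    rw [boxProportion_forall_mem B _ _ hM]
    have h1 : ((({0} : Set (𝓞 K)) ∩ integralBox B M).ncard : ℝ) ≤ 1 := by
      have := Set.ncard_le_ncard (Set.inter_subset_left :
        ({0} : Set (𝓞 K)) ∩ integralBox B M ⊆ {0})
      rw [Set.ncard_singleton] at this
      exact_mod_cast this
    calc _ ≤ (1 / (2 * M : ℝ) ^ Fintype.card ι) ^ e.ncard := by gcongr
      _ ≤ (1 / (2 * M : ℝ)) ^ e.ncard := by
          gcongr
          exact le_self_pow₀ (by linarith) Fintype.card_ne_zero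
      _ ≤ 1 / (2 * M : ℝ) := by
          refine pow_le_of_le_one (by positivity) ?_ he
          rw [div_le_one (by positivity)]
          linarith
  have hT : ∀ p ∈ hgood.toFinset, boxProportion B (T p) M ≤
      C ^ e.ncard * (1 / (Ideal.absNorm p.asIdeal : ℝ) ^ 2) := by
    intro p hp
    rw [Set.Finite.mem_toFinset] at hp
    have hNpos := absNorm_height_one_pos p
    have hN1 : (1 : ℝ) ≤ Ideal.absNorm p.asIdeal := by exact_mod_cast hNpos
    rw [boxProportion_forall_mem B _ _ hM]
    calc _ ≤ (C / Ideal.absNorm (p.asIdeal ^ r)) ^ e.ncard := by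
          exact pow_le_pow_left₀ (by positivity) (hC _ M hp.2) _
      _ = C ^ e.ncard * (1 / (Ideal.absNorm p.asIdeal : ℝ) ^ (r * e.ncard)) := by
          rw [map_pow, Nat.cast_pow, div_pow, ← pow_mul, mul_one_div]
      -- The exponent `r * e.ncard` is at least `2` and the norm is at least `1`.
      _ ≤ _ := by gcongr
  calc _ ≤ _ := boxProportion_mono_of_inter B hsub
    _ ≤ _ := boxProportion_union_le B _ _ M
    _ ≤ 1 / (2 * M) + ∑ p ∈ hgood.toFinset, C ^ e.ncard * (1 / (Ideal.absNorm p.asIdeal : ℝ) ^ 2) :=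
        add_le_add hzero ((boxProportion_biUnion_le B _ _ M).trans (Finset.sum_le_sum hT))
    _ ≤ _ := by
        rw [← Finset.mul_sum]
        gcongr
        refine hε _ (Finset.disjoint_left.mpr fun p hp => ?_)
        rw [Set.Finite.mem_toFinset] at hp
        exact hp.1

end Tail

/-! ### Sums over ideals and the Euler product -/

section IdealSums

variable (K : Type*) [Field K] [NumberField K]

open IsDedekindDomain nonZeroDivisors

/-- The number of nonzero ideals of norm at most `n` is `O(n)`, so the Dirichlet series of the ideal
counts converges at `2`; grouping ideals by norm transfers this. The zero ideal contributes `1 / 0 =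
0`. -/
theorem summable_one_div_absNorm_sq :
    Summable fun I : Ideal (𝓞 K) => 1 / (Ideal.absNorm I : ℝ) ^ 2 := by
  let a : ℕ → ℝ := fun n => Nat.card {I : Ideal (𝓞 K) // Ideal.absNorm I = n}
  have hsum : ∀ n : ℕ, ∑ k ∈ Finset.Icc 1 n, a k =
      (Nat.card {I : (Ideal (𝓞 K))⁰ // (Ideal.absNorm (I : Ideal (𝓞 K)) : ℝ) ≤ (n : ℝ)} : ℝ) := by
    intro n
    simp only [Nat.cast_le, a, ← Nat.cast_sum]
    congr
    -- The added `1` is the zero ideal, the only one of norm `0`; with it the sum runs over all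
    -- ideals.
    rw [← add_left_inj 1, ← Ideal.card_norm_le_eq_card_norm_le_add_one,
      show Finset.Icc 1 n = Finset.Ioc 0 n from Finset.Icc_succ_left_eq_Ioc _ _,
      show 1 = Nat.card {I : Ideal (𝓞 K) // Ideal.absNorm I = 0} by
        simp [Ideal.absNorm_eq_zero_iff],
      Finset.sum_Ioc_add_eq_sum_Icc (n.zero_le),
      ← Finset.card_preimage_eq_sum_card_image_eq
        (fun k _ ↦ Ideal.finite_setOfPred_absNorm_eq k)]
    simp [Set.coe_eq_subtype]
  have hO : (fun n : ℕ => ∑ k ∈ Finset.Icc 1 n, a k) =O[atTop] fun n : ℕ => (n : ℝ) ^ (1 : ℝ) := by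
    have h := (NumberField.Ideal.tendsto_norm_le_div_atTop₀ K).comp tendsto_natCast_atTop_atTop
    simp only [Real.rpow_one]
    refine Asymptotics.isBigO_of_div_tendsto_nhds ?_ _ (h.congr fun n => ?_)
    · filter_upwards [eventually_gt_atTop 0] with n hn h
      exact absurd h (by positivity)
    · simp [hsum]
  have hL := LSeriesSummable_of_sum_norm_bigO_and_nonneg (s := 2) hO
    (fun n => Nat.cast_nonneg _) zero_le_one (by norm_num)
  have hL' : Summable fun n : ℕ => a n / (n : ℝ) ^ 2 := by
    refine hL.norm.congr fun n => ?_
    rcases eq_or_ne n 0 with rfl | hn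
    · simp
    · rw [LSeries.term_of_ne_zero hn]
      simp [a]
  rw [← (Equiv.sigmaFiberEquiv (Ideal.absNorm : Ideal (𝓞 K) → ℕ)).summable_iff,
    summable_sigma_of_nonneg fun _ => by simp only [Function.comp_apply]; positivity]
  have hfin : ∀ n, Finite {I : Ideal (𝓞 K) // Ideal.absNorm I = n} :=
    fun n => Ideal.finite_setOfPred_absNorm_eq n
  refine ⟨fun n => Summable.of_finite, hL'.congr fun n => ?_⟩
  have := Fintype.ofFinite {I : Ideal (𝓞 K) // Ideal.absNorm I = n}
  have h1 : ∀ I : {I : Ideal (𝓞 K) // Ideal.absNorm I = n},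
      ((fun I : Ideal (𝓞 K) => 1 / (Ideal.absNorm I : ℝ) ^ 2) ∘
        (Equiv.sigmaFiberEquiv (Ideal.absNorm : Ideal (𝓞 K) → ℕ))) ⟨n, I⟩ = 1 / (n : ℝ) ^ 2 := by
    rintro ⟨I, hI⟩
    simp [Equiv.sigmaFiberEquiv, hI]
  rw [tsum_congr h1, tsum_fintype, Finset.sum_const, Finset.card_univ, nsmul_eq_mul,
    ← Nat.card_eq_fintype_card, mul_one_div]

theorem summable_one_div_absNorm_height_one_sq :
    Summable fun p : HeightOneSpectrum (𝓞 K) => 1 / (Ideal.absNorm p.asIdeal : ℝ) ^ 2 :=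
  (summable_one_div_absNorm_sq K).comp_injective fun _ _ h => HeightOneSpectrum.ext h

/-- The series `∑ 1 / N(I)` over the ideals diverges. -/
theorem not_summable_one_div_absNorm :
    ¬ Summable fun I : Ideal (𝓞 K) => 1 / (Ideal.absNorm I : ℝ) := by
  classical
  intro hs
  have hlim := NumberField.Ideal.tendsto_norm_le_div_atTop₀ K
  have hc := NumberField.dedekindZeta_residue_pos K
  rw [← NumberField.dedekindZeta_residue_def] at hlim
  set c := NumberField.dedekindZeta_residue K
  -- Outside `F` the sum stays below `c / 2`, yet each nonzero ideal of norm at most `s` contributes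
  -- at least `1 / s`. So the ideal count divided by `s` would have limit at most `c / 2`, whereas
  -- the limit is `c > 0`.
  obtain ⟨F, hF⟩ := hs.vanishing (Iio_mem_nhds (half_pos hc))
  have hbound : ∀ᶠ s : ℝ in atTop,
      (Nat.card {I : (Ideal (𝓞 K))⁰ // (Ideal.absNorm (I : Ideal (𝓞 K)) : ℝ) ≤ s} : ℝ) / s ≤
        F.card / s + c / 2 := by
    filter_upwards [eventually_gt_atTop 0] with s hs
    have hfin : {I : Ideal (𝓞 K) | I ≠ ⊥ ∧ (Ideal.absNorm I : ℝ) ≤ s}.Finite := by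
      refine (Ideal.finite_setOfPred_absNorm_le (S := 𝓞 K) ⌊s⌋₊).subset fun I hI => ?_
      exact Nat.le_floor hI.2
    have hcard : Nat.card {I : (Ideal (𝓞 K))⁰ // (Ideal.absNorm (I : Ideal (𝓞 K)) : ℝ) ≤ s} =
        hfin.toFinset.card := by
      rw [← Set.ncard_eq_toFinset_card _ hfin, ← Nat.card_coe_set_eq]
      exact Nat.card_congr
        { toFun := fun I => ⟨I.1.1, nonZeroDivisors.ne_zero I.1.2, I.2⟩
          invFun := fun I => ⟨⟨I.1, mem_nonZeroDivisors_of_ne_zero I.2.1⟩, I.2.2⟩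
          left_inv := fun _ => rfl
          right_inv := fun _ => rfl }
    have h1 : ∑ I ∈ hfin.toFinset \ F, 1 / (Ideal.absNorm I : ℝ) < c / 2 :=
      hF _ Finset.sdiff_disjoint
    have h2 : ((hfin.toFinset \ F).card : ℝ) / s ≤
        ∑ I ∈ hfin.toFinset \ F, 1 / (Ideal.absNorm I : ℝ) := by
      rw [div_eq_mul_one_div, ← nsmul_eq_mul]
      refine Finset.card_nsmul_le_sum _ _ _ fun I hI => ?_
      have hI' := (hfin.mem_toFinset.mp (Finset.mem_sdiff.mp hI).1)
      have hpos : 0 < Ideal.absNorm I :=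
        Nat.pos_of_ne_zero fun h => hI'.1 (Ideal.absNorm_eq_zero_iff.mp h)
      have hpos' : (0 : ℝ) < Ideal.absNorm I := by exact_mod_cast hpos
      exact one_div_le_one_div_of_le hpos' hI'.2
    have h3 : (hfin.toFinset.card : ℝ) ≤ F.card + (hfin.toFinset \ F).card := by
      have := Finset.card_le_card_sdiff_add_card (s := hfin.toFinset) (t := F)
      rw [add_comm] at this
      exact_mod_cast this
    rw [hcard]
    calc (hfin.toFinset.card : ℝ) / s ≤ (F.card + (hfin.toFinset \ F).card) / s := by gcongr
      _ = F.card / s + (hfin.toFinset \ F).card / s := add_div _ _ _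
      _ ≤ _ := by linarith
  have hlim2 : Tendsto (fun s : ℝ => (F.card : ℝ) / s + c / 2) atTop (nhds (0 + c / 2)) :=
    (tendsto_const_nhds.div_atTop tendsto_id).add tendsto_const_nhds
  have := le_of_tendsto_of_tendsto hlim hlim2 hbound
  linarith

/-- A finite form of the Euler product. -/
theorem exists_sum_one_div_absNorm_le_prod (F : Finset (Ideal (𝓞 K))) :
    ∃ S : Finset (HeightOneSpectrum (𝓞 K)), ∑ I ∈ F, 1 / (Ideal.absNorm I : ℝ) ≤
      ∏ p ∈ S, (1 - 1 / (Ideal.absNorm p.asIdeal : ℝ))⁻¹ := by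
  classical
  have hbot : ∑ I ∈ F, 1 / (Ideal.absNorm I : ℝ) =
      ∑ I ∈ F.filter (· ≠ ⊥), 1 / (Ideal.absNorm I : ℝ) := by
    rw [Finset.sum_filter_of_ne]
    rintro I - h rfl
    simp at h
  rw [hbot]
  set G := F.filter (· ≠ ⊥) with hG
  have hG0 : ∀ I ∈ G, I ≠ 0 := fun I hI => (Finset.mem_filter.mp hI).2
  let ex : Ideal (𝓞 K) → HeightOneSpectrum (𝓞 K) → ℕ :=
    fun I p => (Associates.mk p.asIdeal).count (Associates.mk I).factors
  have hfin : ∀ I ∈ G, (Function.mulSupport fun p : HeightOneSpectrum (𝓞 K) => p.maxPowDividing I).Finite :=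
    fun I hI => Ideal.hasFiniteMulSupport (hG0 I hI)
  have hfinG : (⋃ I ∈ G, Function.mulSupport
      fun p : HeightOneSpectrum (𝓞 K) => p.maxPowDividing I).Finite :=
    G.finite_toSet.biUnion fun I hI => hfin I hI
  let S := hfinG.toFinset
  have hprod : ∀ I ∈ G, I = ∏ p ∈ S, p.asIdeal ^ ex I p := by
    intro I hI
    conv_lhs => rw [← Ideal.finprod_heightOneSpectrum_factorization (hG0 I hI)]
    rw [finprod_eq_prod_of_mulSupport_subset (s := S)]
    · rfl
    · intro p hp
      simp only [S, Set.Finite.coe_toFinset, Set.mem_iUnion]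
      exact ⟨I, hI, hp⟩
  -- A common strict bound on all exponents: by unique factorization the sum over `G` is then part
  -- of the expanded product of geometric sums of length `k`.
  obtain ⟨k, hk⟩ : ∃ k : ℕ, ∀ I ∈ G, ∀ p ∈ S, ex I p < k := by
    refine ⟨∑ I ∈ G, ∑ p ∈ S, ex I p + 1, fun I hI p hp => Nat.lt_succ_of_le ?_⟩
    refine le_trans ?_ (Finset.single_le_sum (f := fun I => ∑ p ∈ S, ex I p)
      (fun _ _ => Nat.zero_le _) hI)
    exact Finset.single_le_sum (f := fun p => ex I p) (fun _ _ => Nat.zero_le _) hp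
  let r : Ideal (𝓞 K) → S → ℕ := fun I p => ex I p
  have hprod' : ∀ I ∈ G, I = ∏ p : S, p.1.asIdeal ^ r I p := by
    intro I hI
    rw [Finset.prod_coe_sort S (fun p => p.asIdeal ^ ex I p)]
    exact hprod I hI
  refine ⟨S, ?_⟩
  let g : (S → ℕ) → ℝ := fun e => ∏ p : S, (1 / (Ideal.absNorm p.1.asIdeal : ℝ)) ^ e p
  have hterm : ∀ I ∈ G, 1 / (Ideal.absNorm I : ℝ) = g (r I) := by
    intro I hI
    conv_lhs => rw [hprod' I hI]
    simp only [map_prod, map_pow, Nat.cast_prod, Nat.cast_pow, g, one_div, inv_pow,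
      Finset.prod_inv_distrib]
  have hinj : Set.InjOn r G := fun I hI J hJ h => by
    rw [hprod' I hI, hprod' J hJ, h]
  have hp1 : ∀ p : HeightOneSpectrum (𝓞 K), 1 < (Ideal.absNorm p.asIdeal : ℝ) := by
    intro p
    have h0 := absNorm_height_one_pos p
    have h1 : Ideal.absNorm p.asIdeal ≠ 1 := fun h =>
      p.isPrime.ne_top (Ideal.absNorm_eq_one_iff.mp h)
    exact_mod_cast (by lia : 1 < Ideal.absNorm p.asIdeal)
  calc ∑ I ∈ G, 1 / (Ideal.absNorm I : ℝ) = ∑ e ∈ G.image r, g e := by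
        rw [Finset.sum_image hinj]
        exact Finset.sum_congr rfl hterm
    _ ≤ ∑ e ∈ Fintype.piFinset fun _ : S => Finset.range k, g e := by
        refine Finset.sum_le_sum_of_subset_of_nonneg ?_ fun _ _ _ => by positivity
        intro e he
        obtain ⟨I, hI, rfl⟩ := Finset.mem_image.mp he
        simp only [Fintype.mem_piFinset, Finset.mem_range]
        exact fun p => hk I hI p p.2
    _ = ∏ p : S, ∑ i ∈ Finset.range k, (1 / (Ideal.absNorm p.1.asIdeal : ℝ)) ^ i :=
        (Finset.prod_univ_sum _ _).symm
    _ ≤ ∏ p : S, (1 - 1 / (Ideal.absNorm p.1.asIdeal : ℝ))⁻¹ := by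
        refine Finset.prod_le_prod (fun _ _ => by positivity) fun p _ => ?_
        have h0 : 0 ≤ 1 / (Ideal.absNorm p.1.asIdeal : ℝ) := by positivity
        have h1 : 1 / (Ideal.absNorm p.1.asIdeal : ℝ) < 1 := by
          rw [div_lt_one (by linarith [hp1 p])]
          exact hp1 p
        rw [← tsum_geometric_of_lt_one h0 h1]
        exact (summable_geometric_of_lt_one h0 h1).sum_le_tsum _ fun _ _ => by positivity
    _ = _ := Finset.prod_coe_sort S fun p => (1 - 1 / (Ideal.absNorm p.asIdeal : ℝ))⁻¹

/-- Were all these products at least `ε`, the finite Euler product would bound every partial sum of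
`∑ 1 / N(I)` by `ε⁻¹`, contradicting divergence. -/
theorem exists_prod_one_sub_one_div_absNorm_lt {ε : ℝ} (hε : 0 < ε) :
    ∃ S : Finset (HeightOneSpectrum (𝓞 K)),
      ∏ p ∈ S, (1 - 1 / (Ideal.absNorm p.asIdeal : ℝ)) < ε := by
  by_contra! h
  refine not_summable_one_div_absNorm K
    (summable_of_sum_le (c := ε⁻¹) (fun _ => by positivity) fun F => ?_)
  obtain ⟨S, hS⟩ := exists_sum_one_div_absNorm_le_prod K F
  refine hS.trans ?_
  rw [Finset.prod_inv_distrib]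
  exact inv_anti₀ hε (h S)

end IdealSums

/-! ### Unconditional products of factors in the unit interval -/

section Products

/-- Over a family with values in `[0, 1]`, the finite products converge. -/
theorem hasProd_iInf_of_mem_Icc {α : Type*} {f : α → ℝ} (h0 : ∀ a, 0 ≤ f a) (h1 : ∀ a, f a ≤ 1) :
    HasProd f (⨅ S : Finset α, ∏ a ∈ S, f a) := by
  classical
  have hanti : Antitone fun S : Finset α => ∏ a ∈ S, f a := by
    intro S T hST
    change ∏ a ∈ T, f a ≤ ∏ a ∈ S, f a
    rw [← Finset.prod_sdiff hST]
    exact mul_le_of_le_one_left (Finset.prod_nonneg fun a _ => h0 a)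
      (Finset.prod_le_one (fun a _ => h0 a) fun a _ => h1 a)
  have h := tendsto_atTop_ciInf hanti ⟨0, by
    rintro _ ⟨S, rfl⟩
    exact Finset.prod_nonneg fun a _ => h0 a⟩
  simpa [HasProd, SummationFilter.unconditional_filter] using h

end Products

/-! ### The density of the relatively prime tuples -/

section Density

variable {K : Type*} [Field K] [NumberField K]

open IsDedekindDomain

theorem hWiseRelativelyRPrime_iff {m r : ℕ} (hr : 1 ≤ r) (H : Hypergraph (Fin m))
    (β : Fin m → 𝓞 K) : HWiseRelativelyRPrime H r β ↔
      ∀ p : HeightOneSpectrum (𝓞 K), ∀ e ∈ H.edgeSet, ∃ i ∈ e, β i ∉ p.asIdeal ^ r := by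
  have hdvd : ∀ (I : Ideal (𝓞 K)) (e : Set (Fin m)),
      I ∣ Ideal.span (β '' e) ↔ ∀ i ∈ e, β i ∈ I := fun I e => by
    rw [Ideal.dvd_iff_le, Ideal.span_le, Set.image_subset_iff]
    rfl
  constructor
  · intro h p e he
    have := h e he p.asIdeal p.isPrime
    rw [hdvd] at this
    push Not at this
    exact this
  · intro h e he p hp hpe
    rw [hdvd] at hpe
    by_cases hbot : p = ⊥
    -- The zero prime is already handled by any nonzero prime: since `r ≥ 1`, lying in `⊥ ^ r` means
    -- being `0`, which lies in every `P ^ r`.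
    · obtain ⟨P, hP⟩ := Ideal.exists_maximal (𝓞 K)
      have hP0 : P ≠ ⊥ := Ring.ne_bot_of_isMaximal_of_not_isField hP
        (NumberField.RingOfIntegers.not_isField K)
      obtain ⟨i, hi, hiP⟩ := h ⟨P, hP.isPrime, hP0⟩ e he
      have hi0 := hpe i hi
      rw [hbot, Ideal.bot_pow (by lia), Ideal.mem_bot] at hi0
      exact hiP (hi0 ▸ Ideal.zero_mem _)
    · obtain ⟨i, hi, hip⟩ := h ⟨p, hp, hbot⟩ e he
      exact hip (hpe i hi)

/-- All large primes together contribute little. -/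
theorem exists_boxProportion_tail_lt {r j m : ℕ} (hrj : 2 ≤ r * j) (H : Hypergraph (Fin m))
    (hH : H.IsUniformOn j) {ι : Type*} [Fintype ι] [Nonempty ι] (B : Module.Basis ι ℤ (𝓞 K))
    {ε : ℝ} (hε : 0 < ε) : ∃ S : Finset (HeightOneSpectrum (𝓞 K)), ∀ᶠ M in atTop,
      boxProportion B {β : Fin m → 𝓞 K |
        ∃ p ∉ S, ∃ e ∈ H.edgeSet, ∀ i ∈ e, β i ∈ p.asIdeal ^ r} M < ε := by
  classical
  have hEfin : H.edgeSet.Finite := Set.toFinite _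
  have hC : ∀ e : Set (Fin m), ∃ C : ℝ, 0 < C ∧ (e ∈ H.edgeSet →
      ∀ (S : Finset (HeightOneSpectrum (𝓞 K))) (δ : ℝ),
      (∀ F : Finset (HeightOneSpectrum (𝓞 K)), Disjoint F S →
        ∑ p ∈ F, 1 / (Ideal.absNorm p.asIdeal : ℝ) ^ 2 ≤ δ) → ∀ M : ℕ, 0 < M →
      boxProportion B {β : Fin m → 𝓞 K | ∃ p ∉ S, ∀ i ∈ e, β i ∈ p.asIdeal ^ r} M ≤
        1 / (2 * M) + C * δ) := by
    intro e
    by_cases he : e ∈ H.edgeSet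
    · obtain ⟨C, hC0, hC⟩ := exists_boxProportion_tail_le (r := r) B (e := e)
        (by rwa [hH.ncard_edge e he])
      exact ⟨C, hC0, fun _ => hC⟩
    · exact ⟨1, one_pos, fun h => absurd h he⟩
  choose C hC0 hC using hC
  set E := hEfin.toFinset with hE
  set D := ∑ e ∈ E, C e with hD
  have hD0 : 0 ≤ D := Finset.sum_nonneg fun e _ => (hC0 e).le
  -- Makes `D * δ < ε` for the sum of the edge constants; the remaining `E.card / (2 * M)` tends to
  -- zero.
  set δ := ε / (2 * (D + 1)) with hδdef
  have hδ : 0 < δ := by positivity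
  obtain ⟨S, hS⟩ := (summable_one_div_absNorm_height_one_sq K).vanishing (Iio_mem_nhds hδ)
  refine ⟨S, ?_⟩
  have hlim : Tendsto (fun M : ℕ => (E.card : ℝ) * (1 / (2 * M)) + D * δ) atTop
      (nhds (E.card * 0 + D * δ)) :=
    ((tendsto_const_nhds.div_atTop
      (tendsto_natCast_atTop_atTop.const_mul_atTop (zero_lt_two (α := ℝ)))).const_mul _).add_const _
  have hlt : (E.card : ℝ) * 0 + D * δ < ε := by
    rw [mul_zero, zero_add, hδdef, mul_div_assoc', div_lt_iff₀ (by positivity)]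
    nlinarith
  filter_upwards [hlim.eventually_lt_const hlt, eventually_gt_atTop 0] with M hM hM0
  refine lt_of_le_of_lt ?_ hM
  have hsub : {β : Fin m → 𝓞 K | ∃ p ∉ S, ∃ e ∈ H.edgeSet, ∀ i ∈ e, β i ∈ p.asIdeal ^ r} ⊆
      ⋃ e ∈ E, {β : Fin m → 𝓞 K | ∃ p ∉ S, ∀ i ∈ e, β i ∈ p.asIdeal ^ r} := by
    rintro β ⟨p, hp, e, he, h⟩
    simp only [Set.mem_iUnion]
    exact ⟨e, hEfin.mem_toFinset.mpr he, p, hp, h⟩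
  calc _ ≤ _ := boxProportion_mono B hsub M
    _ ≤ ∑ e ∈ E, _ := boxProportion_biUnion_le B E _ M
    _ ≤ ∑ e ∈ E, (1 / (2 * M) + C e * δ) := Finset.sum_le_sum fun e he =>
        hC e (hEfin.mem_toFinset.mp he) S δ (fun F hF => (hS F hF).le) M hM0
    _ = _ := by
        rw [Finset.sum_add_distrib, Finset.sum_const, nsmul_eq_mul, ← Finset.sum_mul]

/-- If the elements at some vertex have to be units, the product of the local densities
vanishes. -/
theorem iInf_prod_localDensity_le_zero {m : ℕ} (H : Hypergraph (Fin m))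
    (hH : H.vertexSet = Set.univ) {i : Fin m} (hi : {i} ∈ H.edgeSet) :
    ⨅ S : Finset (HeightOneSpectrum (𝓞 K)), ∏ p ∈ S, localDensity K H 1 p ≤ 0 := by
  refine le_of_forall_pos_le_add fun ε hε => ?_
  obtain ⟨S, hS⟩ := exists_prod_one_sub_one_div_absNorm_lt K hε
  rw [zero_add]
  refine (ciInf_le ⟨0, ?_⟩ S).trans (le_trans (Finset.prod_le_prod
    (fun p _ => localDensity_nonneg H hH 1 p) fun p _ => ?_) hS.le)
  · rintro _ ⟨S, rfl⟩
    exact Finset.prod_nonneg fun p _ => localDensity_nonneg H hH 1 p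
  · simpa using localDensity_le_of_singleton_mem H hH 1 p hi

theorem tendsto_boxProportion_hWiseRelativelyRPrime {r j m : ℕ} (hr : 1 ≤ r) (hj : 1 ≤ j)
    (H : Hypergraph (Fin m)) (hH : H.IsUniformOn j) {ι : Type*} [Fintype ι] [Nonempty ι]
    (B : Module.Basis ι ℤ (𝓞 K)) :
    Tendsto (boxProportion B {β : Fin m → 𝓞 K | HWiseRelativelyRPrime H r β}) atTop
      (nhds (⨅ S : Finset (HeightOneSpectrum (𝓞 K)), ∏ p ∈ S, localDensity K H r p)) := by
  classical
  set P := ⨅ S : Finset (HeightOneSpectrum (𝓞 K)), ∏ p ∈ S, localDensity K H r p with hP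
  have hbdd : BddBelow (Set.range fun S : Finset (HeightOneSpectrum (𝓞 K)) =>
      ∏ p ∈ S, localDensity K H r p) := ⟨0, by
    rintro _ ⟨S, rfl⟩
    exact Finset.prod_nonneg fun p _ => localDensity_nonneg H hH.vertexSet_eq r p⟩
  have hPS : ∀ S : Finset (HeightOneSpectrum (𝓞 K)), P ≤ ∏ p ∈ S, localDensity K H r p :=
    fun S => ciInf_le hbdd S
  have hlocal := fun S => tendsto_boxProportion_finset H hH.vertexSet_eq r B S
  rw [tendsto_order]
  constructor
  · intro a ha
    -- Without edges every tuple qualifies, which is the case `S = ∅`. Separating it supplies an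
    -- edge for the case `r = j = 1` below.
    by_cases hE : H.edgeSet = ∅
    · have h1 : {β : Fin m → 𝓞 K | HWiseRelativelyRPrime H r β} = {β : Fin m → 𝓞 K |
          ∀ p ∈ (∅ : Finset (HeightOneSpectrum (𝓞 K))), ∀ e ∈ H.edgeSet, ∃ i ∈ e,
            β i ∉ p.asIdeal ^ r} := by
        ext β
        simp [HWiseRelativelyRPrime, hE]
      rw [h1]
      exact (hlocal ∅).eventually_const_lt (ha.trans_le (hPS ∅))
    obtain ⟨e, he⟩ := Set.nonempty_iff_ne_empty.mpr hE
    by_cases hrj : 2 ≤ r * j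
    -- A tuple good on `S` is either good everywhere or bad outside `S`; the latter costs less than
    -- half of the gap `P - a`.
    · obtain ⟨S, hS⟩ := exists_boxProportion_tail_lt hrj H hH B (half_pos (sub_pos.mpr ha))
      have hlt : a + (P - a) / 2 < ∏ p ∈ S, localDensity K H r p := by linarith [hPS S]
      filter_upwards [hS, (hlocal S).eventually_const_lt hlt] with M h1 h2
      have hsub : {β : Fin m → 𝓞 K | ∀ p ∈ S, ∀ e ∈ H.edgeSet, ∃ i ∈ e, β i ∉ p.asIdeal ^ r} ⊆
          {β : Fin m → 𝓞 K | HWiseRelativelyRPrime H r β} ∪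
          {β : Fin m → 𝓞 K | ∃ p ∉ S, ∃ e ∈ H.edgeSet, ∀ i ∈ e, β i ∈ p.asIdeal ^ r} := by
        intro β hβ
        by_cases hprime : HWiseRelativelyRPrime H r β
        · exact Or.inl hprime
        · rw [hWiseRelativelyRPrime_iff hr] at hprime
          push Not at hprime
          obtain ⟨p, e, he, h⟩ := hprime
          refine Or.inr ⟨p, fun hp => ?_, e, he, h⟩
          obtain ⟨i, hi, hip⟩ := hβ p hp e he
          exact hip (h i hi)
      have h3 := (boxProportion_mono B hsub M).trans (boxProportion_union_le B _ _ M)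
      linarith
    -- An edge is now a single vertex, so `P ≤ 0` and the lower estimate is just nonnegativity of
    -- proportions.
    · obtain ⟨rfl, rfl⟩ : r = 1 ∧ j = 1 := by
        constructor <;> nlinarith
      obtain ⟨i, rfl⟩ := Set.ncard_eq_one.mp (hH.ncard_edge e he)
      have hP0 : P ≤ 0 := iInf_prod_localDensity_le_zero H hH.vertexSet_eq he
      exact Eventually.of_forall fun M =>
        (ha.trans_le hP0).trans_le (boxProportion_nonneg B _ M)
  · intro a ha
    obtain ⟨S, hS⟩ := exists_lt_of_ciInf_lt ha
    filter_upwards [(hlocal S).eventually_lt_const hS] with M hM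
    refine (boxProportion_mono B (fun β hβ => ?_) M).trans_lt hM
    exact fun p _ => (hWiseRelativelyRPrime_iff hr H β).mp hβ p

end Density

/-- The density of the `H`-wise relatively `r`-prime `m`-tuples exists with respect to every
integral basis, and equals the (unconditionally convergent) product of the local factors, whatever
the basis. -/
theorem theorem1p5 (r j m : ℕ) (hr : 1 ≤ r) (hj : 1 ≤ j) (hjm : j ≤ m) (hrm : 2 ≤ r * m)
    (H : Hypergraph (Fin m)) (hH : H.IsUniformOn j)
    (K : Type*) [Field K] [NumberField K] :
    Multipliable (fun p : IsDedekindDomain.HeightOneSpectrum (𝓞 K) => localDensity K H r p) ∧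
    ∀ B : Module.Basis (Fin (Module.finrank ℚ K)) ℤ (𝓞 K),
      HasBoxDensity B {β : Fin m → 𝓞 K | HWiseRelativelyRPrime H r β}
        (∏' p : IsDedekindDomain.HeightOneSpectrum (𝓞 K), localDensity K H r p) := by
  have hprod := hasProd_iInf_of_mem_Icc (localDensity_nonneg (K := K) H hH.vertexSet_eq r)
    (localDensity_le_one H hH.vertexSet_eq r)
  refine ⟨hprod.multipliable, fun B => ?_⟩
  have : Nonempty (Fin (Module.finrank ℚ K)) := ⟨⟨0, Module.finrank_pos⟩⟩
  have h := tendsto_boxProportion_hWiseRelativelyRPrime hr hj H hH B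
  rw [← hprod.tprod_eq] at h
  exact ⟨h.limsup_eq, h.liminf_eq⟩
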